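/- Let $n\ge 2$, let $B^n=\{x\in\mathbb R^n:\|x\|\le 1\}$ be the Euclidean unit ball and, for $\lambda\ge 0$, let $d\mu_\lambda(x)=(1-\|x\|^2)^\lambda\,dx$ on $B^n$. For a polynomial $f\in\mathbb R[x_1,\dots,x_n]$ put $f_{\min}=\min_{x\in B^n}f(x)$ and, for an integer $r\ge 1$, $$E_r^{(\lambda)}(f)=\inf\Big\{\int_{B^n} f\,q\,d\mu_\lambda \;:\; q\in\Sigma_r,\ \int_{B^n} q\,d\mu_\lambda=1\Big\}-f_{\min},$$ where $\Sigma_r$ is the set of sums of squares of real polynomials in $x_1,\dots,x_n$ of total degree at most $2r$. Put also $$\beta_f=\max_{x\in B^n}\|\nabla f(x)\|,\qquad \gamma_f=\tfrac12\max_{x\in B^n}\|\nabla^2 f(x)\|,$$ with the Euclidean norm of the gradient and the spectral norm of the Hessian. (i) If $\lambda=0$, then $E_r^{(0)}(f)=O(1/r^2)$ uniformly: there is a function $c:\mathbb R^2\to(0,\infty)$, depending only on $n$, such that for every polynomial $f$ and every integer $r\ge 1$, $$E_r^{(0)}(f)\le \frac{c(\beta_f,\gamma_f)}{r^2}.$$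 (ii) If $\lambda>0$, then $E_r^{(\lambda)}(f)=O_a(1/r^2)$: there is a function $c:\mathbb R^n\times\mathbb R^2\to(0,\infty)$, depending only on $n$ and $\lambda$, such that for every polynomial $f$, every global minimizer $a$ of $f$ on $B^n$ and every integer $r\ge 1$, $$E_r^{(\lambda)}(f)\le \frac{c(a,\beta_f,\gamma_f)}{r^2}.$$ -/

import Mathlib

open MeasureTheory

noncomputable section

namespace LasserreBall

/-- The polynomial function `ℝⁿ → ℝ` of `f ∈ ℝ[x₁, …, xₙ]`. -/
def polyFun {n : ℕ} (f : MvPolynomial (Fin n) ℝ) : EuclideanSpace ℝ (Fin n) → ℝ :=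
  fun x => MvPolynomial.eval (fun i => x i) f

/-- `Σ_r`: the sums of squares of polynomials, of total degree at most `2r`. -/
def sosCone (n r : ℕ) : Set (MvPolynomial (Fin n) ℝ) :=
  {q | IsSumSq q ∧ q.totalDegree ≤ 2 * r}

/-- The minimum of `f` on the compact set `K`. -/
def fMin {n : ℕ} (K : Set (EuclideanSpace ℝ (Fin n))) (f : MvPolynomial (Fin n) ℝ) : ℝ :=
  sInf (polyFun f '' K)

/-- The measure-based upper bound of order `r`: the infimum of `∫_K f q dμ` over all `q ∈ Σ_r`
with `∫_K q dμ = 1`. -/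
def upperBound {n : ℕ} (K : Set (EuclideanSpace ℝ (Fin n)))
    (μ : Measure (EuclideanSpace ℝ (Fin n))) (f : MvPolynomial (Fin n) ℝ) (r : ℕ) : ℝ :=
  sInf {v : ℝ | ∃ q ∈ sosCone n r,
    ∫ x in K, polyFun q x ∂μ = 1 ∧ v = ∫ x in K, polyFun f x * polyFun q x ∂μ}

/-- The error `E_r(f)` of the bound of order `r`, for `f` on `K` with reference measure `μ`. -/
def ubError {n : ℕ} (K : Set (EuclideanSpace ℝ (Fin n)))
    (μ : Measure (EuclideanSpace ℝ (Fin n))) (f : MvPolynomial (Fin n) ℝ) (r : ℕ) : ℝ :=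
  upperBound K μ f r - fMin K f

/-- `max_{x ∈ K} ‖∇f(x)‖`. -/
def gradConst {n : ℕ} (K : Set (EuclideanSpace ℝ (Fin n))) (f : MvPolynomial (Fin n) ℝ) : ℝ :=
  sSup ((fun x => ‖gradient (polyFun f) x‖) '' K)

/-- `(1/2) max_{x ∈ K} ‖∇²f(x)‖`, where the Hessian is the derivative of the gradient and its
norm is the operator (spectral) norm. -/
def hessConst {n : ℕ} (K : Set (EuclideanSpace ℝ (Fin n))) (f : MvPolynomial (Fin n) ℝ) : ℝ :=
  (1 / 2) * sSup ((fun x => ‖fderiv ℝ (gradient (polyFun f)) x‖) '' K)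

/-- The closed Euclidean unit ball `Bⁿ`. -/
def unitBall (n : ℕ) : Set (EuclideanSpace ℝ (Fin n)) := Metric.closedBall 0 1

/-- The measure `(1 - ‖x‖²)^lam dx` on the unit ball `Bⁿ`. -/
def ballMeasure (n : ℕ) (lam : ℝ) : Measure (EuclideanSpace ℝ (Fin n)) :=
  (volume.restrict (unitBall n)).withDensity
    (fun x => ENNReal.ofReal ((1 - ‖x‖ ^ 2) ^ lam))

end LasserreBall

end

namespace LasserreBall

open scoped InnerProductSpace

/-! Fix a minimizer `a`. `exists_gauge` provides a polynomial `S` of degree at most 2 with values in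
[0,1] on the ball, f - f(a) ≤ A·S there with A = 2|β| + 4|γ|, and S(a + (x - a)/R) ≤ S(x)/R for R ≥
1. If `a` is interior, S = ‖x - a‖²/4; if ‖a‖ = 1, S = (1 - ⟪a, x⟫)/2, because the gradient at `a`
is then a nonpositive multiple of `a`.

It remains to find a univariate p with 2 deg p ≤ r such that the density p(S)² gives S a mean of
O(1/r²). Powers of the Fejér kernel in s = sin² u do this (`exists_needle`), provided the measure of
{M S ≤ R} is at most R^K times that of {M S ≤ 1}. Contraction towards `a` proves this growth with K
= n + ⌈λ⌉ (`ballMeasure_sublevel_le`): volume costs R^n and the weight at most R^λ. No constant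
depends on `a`, so one estimate serves both parts. -/

/-! ### Fejér kernel as a polynomial in sin² u. -/

theorem abs_sin_nat_mul_le (N : ℕ) (u : ℝ) : |Real.sin (N * u)| ≤ N * |Real.sin u| := by
  induction N with
  | zero => simp
  | succ k ih =>
    have h : Real.sin ((k + 1 : ℕ) * u) =
        Real.sin (k * u) * Real.cos u + Real.cos (k * u) * Real.sin u := by
      rw [← Real.sin_add]; push_cast; ring_nf
    rw [h]
    calc _ ≤ |Real.sin (k * u)| * |Real.cos u| + |Real.cos (k * u)| * |Real.sin u| := by
          rw [← abs_mul, ← abs_mul]; exact abs_add_le _ _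
      _ ≤ |Real.sin (k * u)| * 1 + 1 * |Real.sin u| := by
          gcongr
          · exact Real.abs_cos_le_one u
          · exact Real.abs_cos_le_one _
      _ ≤ _ := by push_cast; linarith

/-- The Fejér kernel `(sin (N u) / (N sin u))²` as a polynomial in `s = sin² u`. -/
theorem exists_fejer (N : ℕ) (hN : 1 ≤ N) :
    ∃ P : Polynomial ℝ, P.natDegree ≤ N - 1 ∧ ∀ s ∈ Set.Icc (0 : ℝ) 1,
      0 ≤ P.eval s ∧ P.eval s * (1 + N ^ 2 * s) ≤ 2 ∧ (N ^ 2 * s ≤ 1 → 1 / 4 ≤ P.eval s) := by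
  have hN0 : (0 : ℝ) < N := by exact_mod_cast hN
  -- With 1 - 2s = cos 2u, one has 1 - T_N(1 - 2s) = 2 sin²(N u). The root at 1 allows division by
  -- 2N²s.
  have hroot : (1 - Polynomial.Chebyshev.T ℝ N).IsRoot 1 := by
    simp [Polynomial.IsRoot]
  obtain ⟨G, hG⟩ := Polynomial.dvd_iff_isRoot.2 hroot
  have hdegT : (1 - Polynomial.Chebyshev.T ℝ N).natDegree ≤ N := by
    refine (Polynomial.natDegree_sub_le _ _).trans ?_
    simp
  have hdegG : G.natDegree ≤ N - 1 := by
    by_cases hG0 : G = 0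
    · simp [hG0]
    rw [hG, Polynomial.natDegree_mul (Polynomial.X_sub_C_ne_zero 1) hG0,
      Polynomial.natDegree_X_sub_C] at hdegT
    omega
  set P : Polynomial ℝ := Polynomial.C (-1 / (N : ℝ) ^ 2) *
    G.comp (Polynomial.C (-2) * Polynomial.X + Polynomial.C 1) with hP
  have hPs : ∀ s : ℝ, P.eval s * (2 * N ^ 2 * s) =
      1 - (Polynomial.Chebyshev.T ℝ N).eval (1 - 2 * s) := by
    intro s
    have h := congrArg (Polynomial.eval (1 - 2 * s)) hG
    simp only [Polynomial.eval_sub, Polynomial.eval_one, Polynomial.eval_mul, Polynomial.eval_X,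
      Polynomial.eval_C] at h
    rw [h, hP]
    simp only [Polynomial.eval_mul, Polynomial.eval_C, Polynomial.eval_comp, Polynomial.eval_add,
      Polynomial.eval_X]
    rw [show -2 * s + 1 = 1 - 2 * s by ring]
    field_simp
    ring
  have hpos : ∀ s ∈ Set.Ioc (0 : ℝ) 1,
      0 ≤ P.eval s ∧ P.eval s * (1 + N ^ 2 * s) ≤ 2 ∧ (N ^ 2 * s ≤ 1 → 1 / 4 ≤ P.eval s) := by
    intro s hs
    have hsq : 0 < √s := Real.sqrt_pos.2 hs.1
    have hsq1 : √s ≤ 1 := Real.sqrt_le_one.2 hs.2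
    set u := Real.arcsin √s with hu
    have hsin : Real.sin u = √s := Real.sin_arcsin (by linarith) hsq1
    have hu0 : 0 ≤ u := Real.arcsin_nonneg.2 hsq.le
    have hu1 : u ≤ Real.pi / 2 := Real.arcsin_le_pi_div_two _
    have hs2 : Real.sin u ^ 2 = s := by rw [hsin, Real.sq_sqrt hs.1.le]
    have hcos : Real.cos (2 * u) = 1 - 2 * s := by
      rw [Real.cos_two_mul, Real.cos_sq', hs2]; ring
    have hmain : P.eval s * (N ^ 2 * s) = Real.sin (N * u) ^ 2 := by
      have h := hPs s
      rw [← hcos, Polynomial.Chebyshev.T_real_cos, Int.cast_natCast,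
        show (N : ℝ) * (2 * u) = 2 * (N * u) by ring,
        Real.cos_two_mul, Real.cos_sq'] at h
      linarith
    have hNs : 0 < (N : ℝ) ^ 2 * s := by have := hs.1; positivity
    have hle1 : P.eval s ≤ 1 := by
      have h1 : Real.sin (N * u) ^ 2 ≤ N ^ 2 * s := by
        rw [← hs2, ← mul_pow, ← sq_abs, ← sq_abs (N * Real.sin u), abs_mul, Nat.abs_cast]
        gcongr
        exact abs_sin_nat_mul_le N u
      rw [← hmain] at h1
      exact le_of_mul_le_mul_right (by linarith) hNs
    refine ⟨?_, ?_, ?_⟩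
    · exact nonneg_of_mul_nonneg_left (hmain ▸ sq_nonneg _) hNs
    · have := Real.sin_sq_le_one (N * u)
      linarith
    · intro hN1
      have hpi := Real.pi_pos
      have hNsin : N * Real.sin u ≤ 1 := by
        rw [← hs2, ← mul_pow] at hN1
        exact (abs_le_of_sq_le_sq' (by simpa using hN1) zero_le_one).2
      -- Jordan's inequality is used twice: at u to get N u ≤ π/2, and then at N u itself, with 2/π
      -- ≥ 1/2.
      have hj := Real.mul_le_sin hu0 hu1
      have hNu : N * u ≤ Real.pi / 2 := by
        have : N * (2 / Real.pi * u) ≤ 1 := (mul_le_mul_of_nonneg_left hj hN0.le).trans hNsin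
        have h2 : N * u = Real.pi / 2 * (N * (2 / Real.pi * u)) := by field_simp
        rw [h2]
        nlinarith
      have hj2 := Real.mul_le_sin (by positivity : 0 ≤ N * u) hNu
      have hsu := Real.sin_le hu0
      have h3 : 1 / 2 * (N * Real.sin u) ≤ Real.sin (N * u) := by
        refine le_trans ?_ hj2
        have : (1 : ℝ) / 2 ≤ 2 / Real.pi := by
          rw [div_le_div_iff₀ two_pos hpi]; linarith [Real.pi_le_four]
        have h0 : 0 ≤ Real.sin u := hsin ▸ hsq.le
        gcongr
      have h4 : 1 / 4 * (N ^ 2 * s) ≤ P.eval s * (N ^ 2 * s) := by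
        rw [hmain, ← hs2]
        have h0 : 0 ≤ Real.sin u := hsin ▸ hsq.le
        calc _ = (1 / 2 * (N * Real.sin u)) ^ 2 := by ring
          _ ≤ _ := by gcongr
      exact le_of_mul_le_mul_right h4 hNs
  refine ⟨P, ?_, ?_⟩
  · refine (Polynomial.natDegree_C_mul_le _ _).trans ?_
    refine Polynomial.natDegree_comp_le.trans ?_
    calc _ ≤ G.natDegree * 1 := by
          gcongr
          exact Polynomial.natDegree_linear_le
      _ ≤ _ := by simpa using hdegG
  · intro s hs
    rcases hs.1.eq_or_lt with h0 | h0
    · subst h0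
      have hcl : IsClosed {s : ℝ | 0 ≤ P.eval s ∧ P.eval s * (1 + N ^ 2 * s) ≤ 2 ∧
          1 / 4 ≤ P.eval s} := by
        have hc := P.continuous
        simp only [Set.ofPred_and]
        exact (isClosed_le continuous_const hc).inter
          ((isClosed_le (by fun_prop) continuous_const).inter (isClosed_le continuous_const hc))
      have hN2 : (0 : ℝ) < 1 / N ^ 2 := by positivity
      have hN1 : (1 : ℝ) / N ^ 2 ≤ 1 := by
        rw [div_le_one (by positivity)]
        exact one_le_pow₀ (by exact_mod_cast hN)
      have hsub : Set.Ioo (0 : ℝ) (1 / N ^ 2) ⊆ {s : ℝ | 0 ≤ P.eval s ∧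
          P.eval s * (1 + N ^ 2 * s) ≤ 2 ∧ 1 / 4 ≤ P.eval s} := by
        intro t ht
        obtain ⟨h1, h2, h3⟩ := hpos t ⟨ht.1, ht.2.le.trans hN1⟩
        refine ⟨h1, h2, h3 ?_⟩
        have := ht.2
        rw [lt_div_iff₀ (by positivity)] at this
        linarith
      have hmem := closure_minimal hsub hcl
        (by rw [closure_Ioo hN2.ne]; exact ⟨le_rfl, hN2.le⟩ : (0 : ℝ) ∈ _)
      exact ⟨hmem.1, hmem.2.1, fun _ => hmem.2.2⟩
    · exact hpos s ⟨h0, hs.2⟩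

/-! ### Concentration of needle polynomials. -/

/-- If the sublevel sets of `s` have polynomial growth, then `(1 + M s)^{-(K + 2)}` is concentrated
on `{M s ≤ 1}`. -/
theorem lintegral_decay_le {X : Type} [MeasurableSpace X] (μ : Measure X) {s : X → ℝ}
    (hs : Measurable s) (h0 : ∀ᵐ x ∂μ, 0 ≤ s x) (K : ℕ) {M : ℝ} (hM : 0 < M)
    (hdbl : ∀ R : ℝ, 1 ≤ R → μ {x | M * s x ≤ R} ≤ ENNReal.ofReal (R ^ K) * μ {x | M * s x ≤ 1}) :
    ∫⁻ x, ENNReal.ofReal (((1 + M * s x) ^ (K + 2))⁻¹) ∂μ ≤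
      ENNReal.ofReal (∑' N : ℕ, (((N : ℝ) + 1) ^ 2)⁻¹) * μ {x | M * s x ≤ 1} := by
  have hms : ∀ R : ℝ, MeasurableSet {x | M * s x ≤ R} := fun R =>
    measurableSet_le (hs.const_mul M) measurable_const
  -- The single term N = ⌊M s⌋ already dominates. Growth of order K leaves two powers of N + 1,
  -- enough for summability.
  have hpt : ∀ᵐ x ∂μ, ENNReal.ofReal (((1 + M * s x) ^ (K + 2))⁻¹) ≤
      ∑' N : ℕ, {x | M * s x ≤ (N : ℝ) + 1}.indicator
        (fun _ => ENNReal.ofReal ((((N : ℝ) + 1) ^ (K + 2))⁻¹)) x := by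
    filter_upwards [h0] with x hx
    have hMs : 0 ≤ M * s x := by positivity
    refine le_trans ?_ (ENNReal.le_tsum ⌊M * s x⌋₊)
    rw [Set.indicator_of_mem (by simpa using (Nat.lt_floor_add_one (M * s x)).le)]
    apply ENNReal.ofReal_le_ofReal
    have := Nat.floor_le hMs
    have h2 : (⌊M * s x⌋₊ : ℝ) + 1 ≤ 1 + M * s x := by linarith
    gcongr
  have hsum : Summable fun N : ℕ => (((N : ℝ) + 1) ^ 2)⁻¹ := by
    have := (summable_nat_add_iff 1).2 (Real.summable_nat_pow_inv.2 one_lt_two)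
    simpa using this
  calc _ ≤ ∫⁻ x, ∑' N : ℕ, {x | M * s x ≤ (N : ℝ) + 1}.indicator
        (fun _ => ENNReal.ofReal ((((N : ℝ) + 1) ^ (K + 2))⁻¹)) x ∂μ := lintegral_mono_ae hpt
    _ = ∑' N : ℕ, ENNReal.ofReal ((((N : ℝ) + 1) ^ (K + 2))⁻¹) *
          μ {x | M * s x ≤ (N : ℝ) + 1} := by
        rw [lintegral_tsum fun N => (measurable_const.indicator (hms _)).aemeasurable]
        congr with N
        rw [lintegral_indicator_const (hms _)]
    _ ≤ ∑' N : ℕ, ENNReal.ofReal ((((N : ℝ) + 1) ^ 2)⁻¹) * μ {x | M * s x ≤ 1} := by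
        refine ENNReal.tsum_le_tsum fun N => ?_
        refine (mul_le_mul_right (hdbl (N + 1) (by simp)) _).trans ?_
        rw [← mul_assoc, ← ENNReal.ofReal_mul (by positivity)]
        refine le_of_eq ?_
        congr 2
        rw [pow_add]
        field_simp
    _ = _ := by
        rw [ENNReal.tsum_mul_right, ENNReal.ofReal_tsum_of_nonneg (fun N => by positivity) hsum]

/-- The polynomial is chosen before the measure and the gauge, so its constant is uniform over
minimizers. A power of the Fejér kernel is bounded below on {M s ≤ 1} and decays faster than the
sublevel sets grow, with M = N² of order r². -/
theorem exists_needle (K : ℕ) :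
    ∃ C : ℝ, 0 < C ∧ ∀ r : ℕ, 1 ≤ r → ∃ p : Polynomial ℝ, 2 * p.natDegree ≤ r ∧
      ∀ {X : Type} [MeasurableSpace X] (μ : Measure X) [IsFiniteMeasure μ] (s : X → ℝ),
        Measurable s → (∀ᵐ x ∂μ, s x ∈ Set.Icc (0 : ℝ) 1) → μ Set.univ ≠ 0 →
        (∀ M : ℝ, 0 < M → ∀ R : ℝ, 1 ≤ R →
          μ {x | M * s x ≤ R} ≤ ENNReal.ofReal (R ^ K) * μ {x | M * s x ≤ 1}) →
        0 < ∫ x, p.eval (s x) ^ 2 ∂μ ∧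
          ∫ x, s x * p.eval (s x) ^ 2 ∂μ ≤ C / r ^ 2 * ∫ x, p.eval (s x) ^ 2 ∂μ := by
  set S : ℝ := ∑' N : ℕ, (((N : ℝ) + 1) ^ 2)⁻¹ with hS
  have hS0 : 0 ≤ S := tsum_nonneg fun N => by positivity
  -- One power of 1 + M s absorbs the factor s and K + 2 feed the decay lemma. In the constant, 4k²
  -- comes from 1/M, and 64^k = 4^k·16^k from the upper and lower kernel bounds.
  set k : ℕ := K + 3 with hk
  refine ⟨4 * k ^ 2 * (64 ^ k * (S + 1)), by positivity, fun r hr => ?_⟩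
  -- The kernel has degree at most N - 1, so 2k(N - 1) ≤ r meets the degree bound, while r ≤ 2kN
  -- gives the rate.
  set N : ℕ := r / (2 * k) + 1 with hN
  obtain ⟨P, hPdeg, hP⟩ := exists_fejer N (Nat.succ_pos _)
  refine ⟨P ^ k, ?_, ?_⟩
  · calc 2 * (P ^ k).natDegree ≤ 2 * (k * (r / (2 * k))) := by
          gcongr
          refine Polynomial.natDegree_pow_le.trans ?_
          gcongr
          exact hPdeg.trans_eq (Nat.add_sub_cancel _ _)
      _ = (2 * k) * (r / (2 * k)) := by ring
      _ ≤ r := Nat.mul_div_le _ _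
  intro X _ μ _ s hs hs01 hμ hdbl
  have hNpos : (0 : ℝ) < N := by rw [hN]; positivity
  set M : ℝ := (N : ℝ) ^ 2 with hM
  have hM0 : 0 < M := by positivity
  have hM1 : 1 ≤ M := one_le_pow₀ (by rw [hN]; push_cast; linarith [(Nat.cast_nonneg (r / (2 * k)) : (0 : ℝ) ≤ _)])
  have hrN : (r : ℝ) ≤ 2 * k * N := by
    have : r ≤ 2 * k * N := by
      rw [hN, mul_add, mul_one]
      exact (Nat.lt_mul_div_succ r (by positivity : 0 < 2 * k)).le
    exact_mod_cast this
  have hMr : 1 / M ≤ 4 * k ^ 2 / r ^ 2 := by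
    have hr0 : (0 : ℝ) < r := by exact_mod_cast hr
    rw [div_le_div_iff₀ hM0 (by positivity), hM]
    calc 1 * (r : ℝ) ^ 2 ≤ (2 * k * N) ^ 2 := by rw [one_mul]; gcongr
      _ = _ := by ring
  have hms : MeasurableSet {x | M * s x ≤ 1} :=
    measurableSet_le (hs.const_mul M) measurable_const
  set m : ℝ := μ.real {x | M * s x ≤ 1} with hm
  have hm0 : 0 < m := by
    refine ENNReal.toReal_pos ?_ (measure_ne_top _ _)
    intro h0
    -- With R = M the larger sublevel set has full measure, as s ≤ 1.
    have h1 := hdbl M hM0 M hM1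
    rw [h0, mul_zero, nonpos_iff_eq_zero] at h1
    refine hμ (measure_mono_null_ae ?_ h1)
    filter_upwards [hs01] with x hx _
    exact mul_le_of_le_one_right hM0.le hx.2
  have hPc : Measurable fun x => (P ^ k).eval (s x) := (P ^ k).continuous.measurable.comp hs
  have hbd : ∀ᵐ x ∂μ, 0 ≤ P.eval (s x) ∧ P.eval (s x) * (1 + M * s x) ≤ 2 ∧
      (M * s x ≤ 1 → 1 / 4 ≤ P.eval (s x)) ∧ P.eval (s x) ≤ 2 := by
    filter_upwards [hs01] with x hx
    obtain ⟨h1, h2, h3⟩ := hP _ hx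
    refine ⟨h1, h2, h3, ?_⟩
    nlinarith [mul_nonneg h1 (mul_nonneg hM0.le hx.1)]
  have hint : Integrable (fun x => (P ^ k).eval (s x) ^ 2) μ := by
    refine Integrable.of_bound (hPc.pow_const 2).aestronglyMeasurable ((2 ^ k) ^ 2) ?_
    filter_upwards [hbd] with x hx
    rw [Polynomial.eval_pow, norm_pow, norm_pow, Real.norm_of_nonneg hx.1]
    have := hx.1
    gcongr
    exact hx.2.2.2
  have hlow : (1 / 16) ^ k * m ≤ ∫ x, (P ^ k).eval (s x) ^ 2 ∂μ := by
    calc (1 / 16 : ℝ) ^ k * m = ∫ x, {x | M * s x ≤ 1}.indicator (fun _ => (1 / 16 : ℝ) ^ k) x ∂μ := by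
          rw [integral_indicator_const _ hms, smul_eq_mul, mul_comm]
      _ ≤ _ := by
          refine integral_mono_ae ((integrable_const _).indicator hms) hint ?_
          filter_upwards [hbd] with x hx
          by_cases hx1 : M * s x ≤ 1
          · rw [Set.indicator_of_mem (by exact hx1), Polynomial.eval_pow, ← pow_mul, mul_comm k,
              pow_mul]
            gcongr
            calc (1 / 16 : ℝ) = (1 / 4) ^ 2 := by norm_num
              _ ≤ _ := by gcongr; exact hx.2.2.1 hx1
          · rw [Set.indicator_of_notMem (by exact hx1)]
            positivity
  have hup : ∫ x, s x * (P ^ k).eval (s x) ^ 2 ∂μ ≤ 1 / M * (4 ^ k * (S * m)) := by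
    have hdec := lintegral_decay_le μ hs (hs01.mono fun x hx => hx.1) K hM0 (hdbl M hM0)
    have hle : ∀ᵐ x ∂μ, s x * (P ^ k).eval (s x) ^ 2 ≤
        1 / M * 4 ^ k * ((1 + M * s x) ^ (K + 2))⁻¹ := by
      filter_upwards [hbd, hs01] with x hx hx01
      set t := M * s x with ht
      have ht0 : 0 ≤ t := mul_nonneg hM0.le hx01.1
      have hst : s x = 1 / M * t := by rw [ht]; field_simp
      have h1 : ((P.eval (s x)) * (1 + t)) ^ (2 * k) ≤ 2 ^ (2 * k) :=
        pow_le_pow_left₀ (mul_nonneg hx.1 (by linarith)) hx.2.1 _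
      have h2 : t * (1 + t) ^ (K + 2) ≤ (1 + t) ^ (2 * k) := by
        calc t * (1 + t) ^ (K + 2) ≤ (1 + t) * (1 + t) ^ (K + 2) := by gcongr; linarith
          _ = (1 + t) ^ (K + 3) := by ring
          _ ≤ _ := pow_le_pow_right₀ (by linarith) (by omega)
      rw [← div_eq_mul_inv, le_div_iff₀ (by positivity)]
      calc s x * (P ^ k).eval (s x) ^ 2 * (1 + t) ^ (K + 2)
          = 1 / M * (P.eval (s x) ^ (2 * k) * (t * (1 + t) ^ (K + 2))) := by
            rw [Polynomial.eval_pow, hst]; ring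
        _ ≤ 1 / M * (P.eval (s x) ^ (2 * k) * (1 + t) ^ (2 * k)) := by
            have := pow_nonneg hx.1 (2 * k)
            gcongr
        _ ≤ 1 / M * 4 ^ k := by
            gcongr
            rw [← mul_pow]
            refine h1.trans_eq ?_
            rw [pow_mul]; norm_num
    have hdm : Measurable fun x => ((1 + M * s x) ^ (K + 2))⁻¹ := by fun_prop
    have hdn : ∀ᵐ x ∂μ, 0 ≤ ((1 + M * s x) ^ (K + 2))⁻¹ := by
      filter_upwards [hs01] with x hx
      have := hx.1
      positivity
    have hdi : Integrable (fun x => ((1 + M * s x) ^ (K + 2))⁻¹) μ := by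
      refine Integrable.of_bound hdm.aestronglyMeasurable 1 ?_
      filter_upwards [hdn, hs01] with x hx hx01
      rw [Real.norm_of_nonneg hx]
      exact inv_le_one_of_one_le₀ (one_le_pow₀ (by linarith [mul_nonneg hM0.le hx01.1]))
    have hdS : ∫ x, ((1 + M * s x) ^ (K + 2))⁻¹ ∂μ ≤ S * m := by
      rw [integral_eq_lintegral_of_nonneg_ae hdn hdm.aestronglyMeasurable]
      refine (ENNReal.toReal_mono (by finiteness) hdec).trans_eq ?_
      rw [ENNReal.toReal_mul, ENNReal.toReal_ofReal hS0]
      rfl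
    calc _ ≤ ∫ x, 1 / M * 4 ^ k * ((1 + M * s x) ^ (K + 2))⁻¹ ∂μ := by
          refine integral_mono_of_nonneg ?_ (hdi.const_mul _) hle
          filter_upwards [hs01] with x hx
          exact mul_nonneg hx.1 (sq_nonneg _)
      _ = 1 / M * 4 ^ k * ∫ x, ((1 + M * s x) ^ (K + 2))⁻¹ ∂μ := integral_const_mul _ _
      _ ≤ 1 / M * 4 ^ k * (S * m) := by gcongr
      _ = _ := by ring
  refine ⟨lt_of_lt_of_le (by positivity) hlow, hup.trans ?_⟩
  calc 1 / M * (4 ^ k * (S * m)) ≤ 4 * k ^ 2 / r ^ 2 * (4 ^ k * ((S + 1) * m)) := by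
        gcongr
        linarith
    _ = 4 * k ^ 2 * (64 ^ k * (S + 1)) / r ^ 2 * ((1 / 16) ^ k * m) := by
        rw [show (64 : ℝ) = 4 * 16 by norm_num, mul_pow, one_div, inv_pow]
        field_simp
    _ ≤ _ := by gcongr

/-! ### The weighted ball measure under contractions. -/

theorem lintegral_contract {n : ℕ} (F : EuclideanSpace ℝ (Fin n) → ENNReal)
    (a : EuclideanSpace ℝ (Fin n)) {R : ℝ} (hR : 0 < R) (hF : Measurable F) :
    ∫⁻ x, F (a + R⁻¹ • (x - a)) = ENNReal.ofReal (R ^ n) * ∫⁻ x, F x := by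
  have h1 : ∫⁻ x, F (a + R⁻¹ • (x - a)) = ∫⁻ x, F (a + R⁻¹ • x) :=
    lintegral_sub_right_eq_self (fun x => F (a + R⁻¹ • x)) a
  have h2 : ∫⁻ x, F (a + R⁻¹ • x) =
      ∫⁻ y, F (a + y) ∂(Measure.map (fun x => R⁻¹ • x) volume) := by
    rw [lintegral_map (by fun_prop) (by fun_prop)]
  have h3 := Measure.map_addHaar_smul (volume : Measure (EuclideanSpace ℝ (Fin n)))
    (inv_ne_zero hR.ne')
  rw [h1, h2]
  erw [h3]
  rw [lintegral_smul_measure, lintegral_add_left_eq_self, finrank_euclideanSpace_fin, inv_pow,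
    inv_inv, abs_of_pos (by positivity), smul_eq_mul]

theorem measurable_ballWeight {n : ℕ} (lam : ℝ) :
    Measurable fun x : EuclideanSpace ℝ (Fin n) => ENNReal.ofReal ((1 - ‖x‖ ^ 2) ^ lam) := by
  fun_prop

theorem ballMeasure_apply {n : ℕ} (lam : ℝ) {A : Set (EuclideanSpace ℝ (Fin n))}
    (hA : MeasurableSet A) :
    ballMeasure n lam A = ∫⁻ x, (unitBall n ∩ A).indicator
      (fun x => ENNReal.ofReal ((1 - ‖x‖ ^ 2) ^ lam)) x := by
  have hB : MeasurableSet (unitBall n) := Metric.isClosed_closedBall.measurableSet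
  rw [ballMeasure, withDensity_apply _ hA, Measure.restrict_restrict hA,
    lintegral_indicator (hB.inter hA), Set.inter_comm]

theorem contract_mem_unitBall {n : ℕ} {a x : EuclideanSpace ℝ (Fin n)} (ha : a ∈ unitBall n)
    (hx : x ∈ unitBall n) {R : ℝ} (hR : 1 ≤ R) : a + R⁻¹ • (x - a) ∈ unitBall n :=
  (convex_closedBall 0 1).add_smul_sub_mem ha hx
    ⟨by positivity, inv_le_one_of_one_le₀ hR⟩

/-- Convexity of ‖·‖², with the term in 1 - ‖a‖² ≥ 0 dropped; hence the uniformity in `a`, even on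
the sphere. -/
theorem one_sub_norm_sq_contract {n : ℕ} {a x : EuclideanSpace ℝ (Fin n)} (ha : a ∈ unitBall n)
    {R : ℝ} (hR : 1 ≤ R) :
    R⁻¹ * (1 - ‖x‖ ^ 2) ≤ 1 - ‖a + R⁻¹ • (x - a)‖ ^ 2 := by
  have hR0 : 0 ≤ R⁻¹ := by positivity
  have hR1 : R⁻¹ ≤ 1 := inv_le_one_of_one_le₀ hR
  have hc := (convexOn_univ_norm (E := EuclideanSpace ℝ (Fin n))).pow (fun _ _ => norm_nonneg _) 2
  have h := hc.2 (Set.mem_univ a) (Set.mem_univ x) (sub_nonneg.2 hR1) hR0 (by ring)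
  have he : (1 - R⁻¹) • a + R⁻¹ • x = a + R⁻¹ • (x - a) := by module
  rw [he] at h
  simp only [Pi.pow_apply, smul_eq_mul] at h
  have ha1 : ‖a‖ ^ 2 ≤ 1 := by
    have : ‖a‖ ≤ 1 := by simpa [unitBall] using ha
    exact pow_le_one₀ (norm_nonneg _) this
  nlinarith

/-- The contraction maps the part of {M s ≤ R} in the ball into {M s ≤ 1}. Its Jacobian gives R^n,
and the weight loses at most R^λ ≤ R^L. -/
theorem ballMeasure_sublevel_le {n : ℕ} {lam : ℝ} (hlam : 0 ≤ lam) {L : ℕ} (hL : lam ≤ L)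
    {a : EuclideanSpace ℝ (Fin n)} (ha : a ∈ unitBall n) {s : EuclideanSpace ℝ (Fin n) → ℝ}
    (hs : Measurable s)
    (hsc : ∀ x ∈ unitBall n, ∀ R : ℝ, 1 ≤ R → s (a + R⁻¹ • (x - a)) ≤ R⁻¹ * s x)
    {M : ℝ} (hM : 0 < M) {R : ℝ} (hR : 1 ≤ R) :
    ballMeasure n lam {x | M * s x ≤ R} ≤
      ENNReal.ofReal (R ^ (n + L)) * ballMeasure n lam {x | M * s x ≤ 1} := by
  have hms : ∀ R : ℝ, MeasurableSet {x | M * s x ≤ R} := fun R =>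
    measurableSet_le (hs.const_mul M) measurable_const
  have hB : MeasurableSet (unitBall n) := Metric.isClosed_closedBall.measurableSet
  have hR0 : 0 < R := by linarith
  set w : EuclideanSpace ℝ (Fin n) → ENNReal := fun x => ENNReal.ofReal ((1 - ‖x‖ ^ 2) ^ lam)
    with hw
  have hF : Measurable ((unitBall n ∩ {x | M * s x ≤ 1}).indicator w) :=
    (measurable_ballWeight lam).indicator (hB.inter (hms 1))
  rw [ballMeasure_apply lam (hms R), ballMeasure_apply lam (hms 1), pow_add, mul_comm (R ^ n),
    ENNReal.ofReal_mul (by positivity), mul_assoc, ← lintegral_contract _ a hR0 hF,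
    ← lintegral_const_mul' _ _ ENNReal.ofReal_ne_top]
  refine lintegral_mono fun x => ?_
  by_cases hxA : x ∈ unitBall n ∩ {x | M * s x ≤ R}
  swap
  · simp only [Set.indicator_of_notMem hxA, zero_le]
  obtain ⟨hx, hxs⟩ := id hxA
  simp only [Set.indicator_of_mem hxA]
  have hTx := contract_mem_unitBall ha hx hR
  have hTs : M * s (a + R⁻¹ • (x - a)) ≤ 1 := by
    calc M * s (a + R⁻¹ • (x - a)) ≤ M * (R⁻¹ * s x) := by gcongr; exact hsc x hx R hR
      _ = R⁻¹ * (M * s x) := by ring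
      _ ≤ R⁻¹ * R := by gcongr; exact hxs
      _ = 1 := inv_mul_cancel₀ hR0.ne'
  rw [Set.indicator_of_mem (show _ ∈ unitBall n ∩ {x | M * s x ≤ 1} from ⟨hTx, hTs⟩), hw,
    ← ENNReal.ofReal_mul (by positivity)]
  apply ENNReal.ofReal_le_ofReal
  have hx1 : 0 ≤ 1 - ‖x‖ ^ 2 := by
    have : ‖x‖ ≤ 1 := by simpa [unitBall] using hx
    linarith [pow_le_one₀ (norm_nonneg x) this (n := 2)]
  have hg : 0 ≤ 1 - ‖a + R⁻¹ • (x - a)‖ ^ 2 :=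
    le_trans (by positivity) (one_sub_norm_sq_contract (x := x) ha hR)
  calc (1 - ‖x‖ ^ 2) ^ lam ≤ (R * (1 - ‖a + R⁻¹ • (x - a)‖ ^ 2)) ^ lam := by
        gcongr
        have := one_sub_norm_sq_contract (x := x) ha hR
        rwa [inv_mul_le_iff₀ hR0] at this
    _ = R ^ lam * (1 - ‖a + R⁻¹ • (x - a)‖ ^ 2) ^ lam := Real.mul_rpow hR0.le hg
    _ ≤ R ^ L * (1 - ‖a + R⁻¹ • (x - a)‖ ^ 2) ^ lam := by
        gcongr
        rw [← Real.rpow_natCast]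
        exact Real.rpow_le_rpow_of_exponent_le hR hL

theorem ballMeasure_finite {n : ℕ} {lam : ℝ} (hlam : 0 ≤ lam) :
    IsFiniteMeasure (ballMeasure n lam) := by
  refine ⟨?_⟩
  have hB : MeasurableSet (unitBall n) := Metric.isClosed_closedBall.measurableSet
  rw [ballMeasure_apply lam MeasurableSet.univ, Set.inter_univ, lintegral_indicator hB]
  refine lt_of_le_of_lt (setLIntegral_mono measurable_const (g := fun _ => 1) ?_) ?_
  · intro x hx
    have : ‖x‖ ≤ 1 := by simpa [unitBall] using hx
    rw [ENNReal.ofReal_le_one]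
    refine Real.rpow_le_one ?_ ?_ hlam
    · linarith [pow_le_one₀ (norm_nonneg x) this (n := 2)]
    · linarith [sq_nonneg ‖x‖]
  · rw [setLIntegral_const, one_mul]
    exact measure_closedBall_lt_top

theorem ballMeasure_univ_ne_zero {n : ℕ} (lam : ℝ) : ballMeasure n lam Set.univ ≠ 0 := by
  have hB : MeasurableSet (unitBall n) := Metric.isClosed_closedBall.measurableSet
  rw [ballMeasure_apply lam MeasurableSet.univ, Set.inter_univ, lintegral_indicator hB]
  refine (setLIntegral_pos_iff (measurable_ballWeight lam)).2 ?_ |>.ne'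
  refine lt_of_lt_of_le (Metric.measure_ball_pos volume (0 : EuclideanSpace ℝ (Fin n)) one_pos)
    (measure_mono ?_)
  intro x hx
  refine ⟨?_, Metric.ball_subset_closedBall hx⟩
  have : ‖x‖ < 1 := by simpa using hx
  rw [Function.mem_support, ← pos_iff_ne_zero, ENNReal.ofReal_pos]
  apply Real.rpow_pos_of_pos
  linarith [pow_lt_one₀ (norm_nonneg x) this two_ne_zero]

theorem ballMeasure_restrict {n : ℕ} (lam : ℝ) :
    (ballMeasure n lam).restrict (unitBall n) = ballMeasure n lam := by
  have hB : MeasurableSet (unitBall n) := Metric.isClosed_closedBall.measurableSet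
  rw [ballMeasure, restrict_withDensity hB, Measure.restrict_restrict hB, Set.inter_self]

theorem ae_mem_unitBall {n : ℕ} (lam : ℝ) : ∀ᵐ x ∂(ballMeasure n lam), x ∈ unitBall n := by
  rw [← ballMeasure_restrict]
  exact ae_restrict_mem Metric.isClosed_closedBall.measurableSet

/-! ### Taylor bound and first-order conditions. -/

theorem contDiff_polyFun {n : ℕ} (f : MvPolynomial (Fin n) ℝ) (m : WithTop ℕ∞) :
    ContDiff ℝ m (polyFun f) := by
  unfold polyFun
  induction f using MvPolynomial.induction_on with
  | C c => simpa using contDiff_const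
  | add p q hp hq => simpa using hp.add hq
  | mul_X p i hp =>
    simp only [map_mul, MvPolynomial.eval_X]
    exact hp.mul (by fun_prop)

theorem contDiff_gradient_polyFun {n : ℕ} (f : MvPolynomial (Fin n) ℝ) :
    ContDiff ℝ 1 (gradient (polyFun f)) :=
  (InnerProductSpace.toDual ℝ _).symm.contDiff.comp
    ((contDiff_polyFun f 2).fderiv_right (by norm_num))

theorem norm_gradient_le_gradConst {n : ℕ} (f : MvPolynomial (Fin n) ℝ)
    {x : EuclideanSpace ℝ (Fin n)} (hx : x ∈ unitBall n) :
    ‖gradient (polyFun f) x‖ ≤ gradConst (unitBall n) f := by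
  refine le_csSup ?_ (Set.mem_image_of_mem _ hx)
  exact (isCompact_closedBall 0 1).bddAbove_image
    (contDiff_gradient_polyFun f).continuous.norm.continuousOn

theorem norm_fderiv_gradient_le_hessConst {n : ℕ} (f : MvPolynomial (Fin n) ℝ)
    {x : EuclideanSpace ℝ (Fin n)} (hx : x ∈ unitBall n) :
    ‖fderiv ℝ (gradient (polyFun f)) x‖ ≤ 2 * hessConst (unitBall n) f := by
  rw [hessConst, ← mul_assoc, mul_one_div_cancel two_ne_zero, one_mul]
  refine le_csSup ?_ (Set.mem_image_of_mem _ hx)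
  exact (isCompact_closedBall 0 1).bddAbove_image
    ((contDiff_gradient_polyFun f).continuous_fderiv one_ne_zero).norm.continuousOn

theorem hasGradientAt_polyFun {n : ℕ} (f : MvPolynomial (Fin n) ℝ)
    (x : EuclideanSpace ℝ (Fin n)) : HasGradientAt (polyFun f) (gradient (polyFun f) x) x :=
  ((contDiff_polyFun f 1).differentiable one_ne_zero x).hasGradientAt

/-- The Hessian bound makes the gradient 2γ-Lipschitz; along the segment from `a` to `x`, f minus
its quadratic majorant is then antitone. -/
theorem polyFun_le_taylor {n : ℕ} (f : MvPolynomial (Fin n) ℝ)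
    {a x : EuclideanSpace ℝ (Fin n)} (ha : a ∈ unitBall n) (hx : x ∈ unitBall n) :
    polyFun f x ≤ polyFun f a + ⟪gradient (polyFun f) a, x - a⟫_ℝ +
      hessConst (unitBall n) f * ‖x - a‖ ^ 2 := by
  set γ := hessConst (unitBall n) f
  set g := gradient (polyFun f) with hg
  have hmem : ∀ t ∈ Set.Icc (0 : ℝ) 1, a + t • (x - a) ∈ unitBall n := fun t ht =>
    (convex_closedBall 0 1).add_smul_sub_mem ha hx ht
  have hlip : ∀ t ∈ Set.Icc (0 : ℝ) 1, ⟪g (a + t • (x - a)) - g a, x - a⟫_ℝ ≤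
      2 * γ * t * ‖x - a‖ ^ 2 := by
    intro t ht
    have h := (convex_closedBall (0 : EuclideanSpace ℝ (Fin n)) 1).norm_image_sub_le_of_norm_fderiv_le
      (𝕜 := ℝ) (f := g) (fun y _ => (contDiff_gradient_polyFun f).differentiable one_ne_zero y)
      (fun y hy => norm_fderiv_gradient_le_hessConst f hy) ha (hmem t ht)
    rw [add_sub_cancel_left, norm_smul, Real.norm_of_nonneg ht.1] at h
    calc _ ≤ ‖g (a + t • (x - a)) - g a‖ * ‖x - a‖ := real_inner_le_norm _ _
      _ ≤ 2 * γ * (t * ‖x - a‖) * ‖x - a‖ := by gcongr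
      _ = _ := by ring
  set φ : ℝ → ℝ := fun t => polyFun f (a + t • (x - a)) - t * ⟪g a, x - a⟫_ℝ -
    γ * t ^ 2 * ‖x - a‖ ^ 2 with hφ
  have hder : ∀ t : ℝ, HasDerivAt φ (⟪g (a + t • (x - a)), x - a⟫_ℝ - ⟪g a, x - a⟫_ℝ -
      γ * (2 * t) * ‖x - a‖ ^ 2) t := by
    intro t
    have h1 : HasDerivAt (fun t : ℝ => a + t • (x - a)) (x - a) t := by
      simpa using ((hasDerivAt_id t).smul_const (x - a)).const_add a
    have h2 := (hasGradientAt_polyFun f (a + t • (x - a))).hasFDerivAt.comp_hasDerivAt t h1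
    rw [InnerProductSpace.toDual_apply_apply] at h2
    have h3 : HasDerivAt (fun t : ℝ => t * ⟪g a, x - a⟫_ℝ) (⟪g a, x - a⟫_ℝ) t := by
      simpa using (hasDerivAt_id t).mul_const ⟪g a, x - a⟫_ℝ
    have h4 : HasDerivAt (fun t : ℝ => γ * t ^ 2 * ‖x - a‖ ^ 2)
        (γ * (2 * t) * ‖x - a‖ ^ 2) t := by
      simpa using ((hasDerivAt_pow 2 t).const_mul γ).mul_const (‖x - a‖ ^ 2)
    exact (h2.sub h3).sub h4
  have hanti : AntitoneOn φ (Set.Icc 0 1) := by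
    refine antitoneOn_of_hasDerivWithinAt_nonpos (convex_Icc 0 1)
      (fun t _ => (hder t).continuousAt.continuousWithinAt)
      (fun t _ => (hder t).hasDerivWithinAt) ?_
    intro t ht
    rw [interior_Icc] at ht
    have := hlip t ⟨ht.1.le, ht.2.le⟩
    rw [inner_sub_left] at this
    linarith
  have h01 := hanti (Set.left_mem_Icc.2 zero_le_one) (Set.right_mem_Icc.2 zero_le_one) zero_le_one
  simp only [hφ, one_smul, zero_smul, add_zero, add_sub_cancel] at h01
  linarith

theorem gradient_eq_zero_of_isMinOn {n : ℕ} (f : MvPolynomial (Fin n) ℝ)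
    {a : EuclideanSpace ℝ (Fin n)} (ha : ‖a‖ < 1) (hmin : IsMinOn (polyFun f) (unitBall n) a) :
    gradient (polyFun f) a = 0 := by
  have h : IsLocalMin (polyFun f) a := hmin.isLocalMin
    (Filter.mem_of_superset (Metric.isOpen_ball.mem_nhds (by simpa using ha))
      (Metric.ball_subset_closedBall (x := 0) (ε := 1)))
  rw [gradient, h.fderiv_eq_zero, map_zero]

/-- Testing the first-order condition at -g/‖g‖ gives ⟪g, a⟫ ≤ -‖g‖, the equality case of
Cauchy–Schwarz, so g = -‖g‖ a. -/
theorem inner_gradient_of_isMinOn {n : ℕ} (f : MvPolynomial (Fin n) ℝ)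
    {a : EuclideanSpace ℝ (Fin n)} (ha : ‖a‖ = 1) (hmin : IsMinOn (polyFun f) (unitBall n) a)
    (x : EuclideanSpace ℝ (Fin n)) :
    ⟪gradient (polyFun f) a, x - a⟫_ℝ = ‖gradient (polyFun f) a‖ * (1 - ⟪a, x⟫_ℝ) := by
  set g := gradient (polyFun f) a with hg
  have haB : a ∈ unitBall n := by simp [unitBall, ha]
  have hfirst : ∀ y ∈ unitBall n, 0 ≤ ⟪g, y - a⟫_ℝ := by
    intro y hy
    have h := (hmin.localize).hasFDerivWithinAt_nonneg
      (hasGradientAt_polyFun f a).hasFDerivAt.hasFDerivWithinAt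
      (sub_mem_posTangentConeAt_of_segment_subset
        ((convex_closedBall 0 1).segment_subset haB hy))
    rwa [InnerProductSpace.toDual_apply_apply] at h
  have hga : g = -(‖g‖ • a) := by
    by_cases hg0 : g = 0
    · simp [hg0]
    have hgn : ‖g‖ ≠ 0 := norm_ne_zero_iff.2 hg0
    have h := hfirst (-(‖g‖⁻¹ • g)) (by simp [unitBall, norm_smul, hgn])
    rw [inner_sub_right, inner_neg_right, real_inner_smul_right, real_inner_self_eq_norm_sq] at h
    have h2 : ‖g‖⁻¹ * ‖g‖ ^ 2 = ‖g‖ := by field_simp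
    rw [h2] at h
    have h3 : ‖g + ‖g‖ • a‖ ^ 2 ≤ 0 := by
      rw [norm_add_sq_real, real_inner_smul_right, norm_smul, ha, norm_norm]
      nlinarith [norm_nonneg g]
    rw [eq_neg_iff_add_eq_zero, ← norm_eq_zero]
    exact pow_eq_zero_iff two_ne_zero |>.1 (le_antisymm h3 (sq_nonneg _))
  have hga' : ∀ y, ⟪g, y⟫_ℝ = -(‖g‖ * ⟪a, y⟫_ℝ) := fun y => by
    conv_lhs => rw [hga]
    rw [inner_neg_left, real_inner_smul_left]
  rw [hga', inner_sub_right, real_inner_self_eq_norm_sq, ha]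
  ring

/-! ### Competitors of the form p(S)². -/

theorem totalDegree_aeval_le {n : ℕ} (p : Polynomial ℝ) (S : MvPolynomial (Fin n) ℝ) {d : ℕ}
    (hS : S.totalDegree ≤ d) : (Polynomial.aeval S p).totalDegree ≤ p.natDegree * d := by
  rw [Polynomial.aeval_eq_sum_range]
  refine MvPolynomial.totalDegree_finsetSum_le fun i hi => ?_
  rw [MvPolynomial.smul_eq_C_mul]
  refine (MvPolynomial.totalDegree_mul _ _).trans ?_
  rw [MvPolynomial.totalDegree_C, zero_add]
  refine (MvPolynomial.totalDegree_pow _ _).trans ?_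
  gcongr
  exact Nat.lt_succ_iff.1 (Finset.mem_range.1 hi)

theorem polyFun_aeval {n : ℕ} (p : Polynomial ℝ) (S : MvPolynomial (Fin n) ℝ)
    (x : EuclideanSpace ℝ (Fin n)) : polyFun (Polynomial.aeval S p) x = p.eval (polyFun S x) := by
  unfold polyFun
  rw [Polynomial.aeval_eq_sum_range, Polynomial.eval_eq_sum_range, map_sum]
  simp only [MvPolynomial.smul_eval, map_pow]

theorem integrable_ballMeasure {n : ℕ} {lam : ℝ} (hlam : 0 ≤ lam)
    {g : EuclideanSpace ℝ (Fin n) → ℝ} (hg : Continuous g) : Integrable g (ballMeasure n lam) := by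
  have := ballMeasure_finite (n := n) hlam
  obtain ⟨C, hC⟩ := (isCompact_closedBall (0 : EuclideanSpace ℝ (Fin n)) 1).exists_bound_of_continuousOn
    hg.continuousOn
  exact Integrable.of_bound hg.aestronglyMeasurable C
    ((ae_mem_unitBall lam).mono fun x hx => hC x hx)

theorem polyFun_nonneg_of_isSumSq {n : ℕ} {q : MvPolynomial (Fin n) ℝ} (hq : IsSumSq q)
    (x : EuclideanSpace ℝ (Fin n)) : 0 ≤ polyFun q x := by
  induction hq with
  | zero => simp [polyFun]
  | sq_add a _ ih =>
    simp only [polyFun, map_add, map_mul] at ih ⊢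
    exact add_nonneg (mul_self_nonneg _) ih

theorem continuous_polyFun {n : ℕ} (f : MvPolynomial (Fin n) ℝ) : Continuous (polyFun f) :=
  (contDiff_polyFun f 0).continuous

/-- Any competitor `q₀`, not necessarily normalised, bounds the error. -/
theorem ubError_le_of_competitor {n r : ℕ} {lam : ℝ} (hlam : 0 ≤ lam)
    {f h : MvPolynomial (Fin n) ℝ} {a : EuclideanSpace ℝ (Fin n)} (ha : a ∈ unitBall n)
    (hmin : IsMinOn (polyFun f) (unitBall n) a) (hdeg : 2 * h.totalDegree ≤ 2 * r)
    (hpos : 0 < ∫ x, polyFun h x ^ 2 ∂(ballMeasure n lam)) {ε : ℝ}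
    (hε : ∫ x, (polyFun f x - polyFun f a) * polyFun h x ^ 2 ∂(ballMeasure n lam) ≤
      ε * ∫ x, polyFun h x ^ 2 ∂(ballMeasure n lam)) :
    ubError (unitBall n) (ballMeasure n lam) f r ≤ ε := by
  have hf := continuous_polyFun f
  have hfmin : fMin (unitBall n) f = polyFun f a :=
    IsLeast.csInf_eq ⟨Set.mem_image_of_mem _ ha, by rintro _ ⟨x, hx, rfl⟩; exact hmin hx⟩
  rw [ubError, hfmin, upperBound, sub_le_iff_le_add', ballMeasure_restrict]
  set μ := ballMeasure n lam with hμ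
  set I := ∫ x, polyFun h x ^ 2 ∂μ with hI
  set q : MvPolynomial (Fin n) ℝ :=
    (MvPolynomial.C (√I⁻¹) * h) * (MvPolynomial.C (√I⁻¹) * h) with hq
  have hqx : ∀ x, polyFun q x = I⁻¹ * polyFun h x ^ 2 := by
    intro x
    have : √I⁻¹ * √I⁻¹ = I⁻¹ := Real.mul_self_sqrt (by positivity)
    simp only [hq, polyFun, map_mul, MvPolynomial.eval_C]
    linear_combination (MvPolynomial.eval (fun i => x i) h) ^ 2 * this
  have hh := continuous_polyFun h
  have hih : Integrable (fun x => polyFun h x ^ 2) μ :=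
    integrable_ballMeasure hlam (hh.pow 2)
  have hle : ∫ x, polyFun f x * polyFun q x ∂μ ≤ polyFun f a + ε := by
    have h1 : ∀ x, polyFun f x * polyFun q x = I⁻¹ * ((polyFun f x - polyFun f a) *
        polyFun h x ^ 2) + I⁻¹ * polyFun f a * polyFun h x ^ 2 := fun x => by rw [hqx]; ring
    simp_rw [h1]
    rw [integral_add ((integrable_ballMeasure hlam (by fun_prop)).const_mul _)
      (hih.const_mul _), integral_const_mul, integral_const_mul, ← hI]
    calc _ ≤ I⁻¹ * (ε * I) + I⁻¹ * polyFun f a * I :=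
          add_le_add_left (mul_le_mul_of_nonneg_left hε (inv_nonneg.2 hpos.le)) _
      _ = polyFun f a + ε := by field_simp [hpos.ne']; ring
  -- `csInf_le` needs a lower bound for the admissible values: f(a) works, as each density is
  -- nonnegative with mass 1.
  refine le_trans (csInf_le ⟨polyFun f a, ?_⟩ ⟨q, ⟨IsSumSq.mul_self _, ?_⟩, ?_, rfl⟩) hle
  · rintro v ⟨p, ⟨hp, -⟩, hp1, rfl⟩
    have hpc := continuous_polyFun p
    calc polyFun f a = ∫ x, polyFun f a * polyFun p x ∂μ := by
          rw [integral_const_mul, hp1, mul_one]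
      _ ≤ _ := by
          refine integral_mono_ae (integrable_ballMeasure hlam (by fun_prop))
            (integrable_ballMeasure hlam (by fun_prop)) ?_
          filter_upwards [ae_mem_unitBall lam] with x hx
          exact mul_le_mul_of_nonneg_right (hmin hx) (polyFun_nonneg_of_isSumSq hp x)
  · have h1 : (MvPolynomial.C (√I⁻¹) * h).totalDegree ≤ h.totalDegree := by
      refine (MvPolynomial.totalDegree_mul _ _).trans ?_
      simp
    refine (MvPolynomial.totalDegree_mul _ _).trans ?_
    omega
  · simp_rw [hqx]
    rw [integral_const_mul, ← hI, inv_mul_cancel₀ hpos.ne']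

theorem totalDegree_X_sub_C_le {n : ℕ} (c : ℝ) (i : Fin n) :
    (MvPolynomial.X i - MvPolynomial.C c : MvPolynomial (Fin n) ℝ).totalDegree ≤ 1 :=
  (MvPolynomial.totalDegree_sub_C_le _ _).trans (MvPolynomial.totalDegree_X i).le

/-! ### The gauge and the resulting rate. -/

/-- Near a minimizer on the ball, `f - f(a)` is dominated by a polynomial gauge of degree at most
`2` which decreases under contractions towards `a`. -/
theorem exists_gauge {n : ℕ} (f : MvPolynomial (Fin n) ℝ) {a : EuclideanSpace ℝ (Fin n)}
    (ha : a ∈ unitBall n) (hmin : IsMinOn (polyFun f) (unitBall n) a) :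
    ∃ S : MvPolynomial (Fin n) ℝ, S.totalDegree ≤ 2 ∧
      (∀ x ∈ unitBall n, polyFun S x ∈ Set.Icc (0 : ℝ) 1) ∧
      (∀ x ∈ unitBall n, ∀ R : ℝ, 1 ≤ R →
        polyFun S (a + R⁻¹ • (x - a)) ≤ R⁻¹ * polyFun S x) ∧
      ∀ x ∈ unitBall n, polyFun f x - polyFun f a ≤
        (2 * |gradConst (unitBall n) f| + 4 * |hessConst (unitBall n) f|) * polyFun S x := by
  set β := gradConst (unitBall n) f
  set γ := hessConst (unitBall n) f
  have hnorm : ∀ x ∈ unitBall n, ‖x‖ ≤ 1 := fun x hx => by simpa [unitBall] using hx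
  rcases (hnorm a ha).lt_or_eq with h1 | h1
  · have hS : ∀ x, polyFun (MvPolynomial.C (1 / 4) * ∑ i, (MvPolynomial.X i -
        MvPolynomial.C (a i)) ^ 2) x = ‖x - a‖ ^ 2 / 4 := by
      intro x
      simp only [polyFun, map_mul, map_sum, map_pow, map_sub, MvPolynomial.eval_C,
        MvPolynomial.eval_X, EuclideanSpace.norm_sq_eq, PiLp.sub_apply, Real.norm_eq_abs, sq_abs]
      ring
    refine ⟨MvPolynomial.C (1 / 4) * ∑ i, (MvPolynomial.X i - MvPolynomial.C (a i)) ^ 2,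
      ?_, ?_, ?_, ?_⟩
    · refine (MvPolynomial.totalDegree_mul _ _).trans ?_
      rw [MvPolynomial.totalDegree_C, zero_add]
      refine MvPolynomial.totalDegree_finsetSum_le fun i _ => ?_
      refine (MvPolynomial.totalDegree_pow _ _).trans ?_
      have := totalDegree_X_sub_C_le (a i) i
      omega
    · intro x hx
      rw [hS]
      have h2 : ‖x - a‖ ≤ 2 := (norm_sub_le _ _).trans (by linarith [hnorm x hx])
      refine ⟨by positivity, ?_⟩
      nlinarith [norm_nonneg (x - a)]
    · intro x hx R hR
      rw [hS, hS, add_sub_cancel_left, norm_smul, Real.norm_of_nonneg (by positivity)]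
      have hR1 : R⁻¹ ≤ 1 := inv_le_one_of_one_le₀ hR
      have hR0 : 0 ≤ R⁻¹ := by positivity
      calc (R⁻¹ * ‖x - a‖) ^ 2 / 4 = R⁻¹ * (R⁻¹ * (‖x - a‖ ^ 2 / 4)) := by ring
        _ ≤ R⁻¹ * (1 * (‖x - a‖ ^ 2 / 4)) := by gcongr
        _ = _ := by ring
    · intro x hx
      have ht := polyFun_le_taylor f ha hx
      rw [gradient_eq_zero_of_isMinOn f h1 hmin, inner_zero_left] at ht
      rw [hS]
      have h3 : γ * ‖x - a‖ ^ 2 ≤ |γ| * ‖x - a‖ ^ 2 := by gcongr; exact le_abs_self _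
      have h4 : 0 ≤ |β| * ‖x - a‖ ^ 2 := by positivity
      linarith
  · have hS : ∀ x, polyFun (MvPolynomial.C (1 / 2) * (1 - ∑ i, MvPolynomial.C (a i) *
        MvPolynomial.X i)) x = (1 - ⟪a, x⟫_ℝ) / 2 := by
      intro x
      simp only [polyFun, map_mul, map_sum, map_sub, map_one, MvPolynomial.eval_C,
        MvPolynomial.eval_X, PiLp.inner_apply, RCLike.inner_apply, conj_trivial]
      simp_rw [mul_comm (a _)]
      ring
    have hin : ∀ x ∈ unitBall n, |⟪a, x⟫_ℝ| ≤ 1 := fun x hx =>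
      (abs_real_inner_le_norm a x).trans (by rw [h1, one_mul]; exact hnorm x hx)
    refine ⟨MvPolynomial.C (1 / 2) * (1 - ∑ i, MvPolynomial.C (a i) * MvPolynomial.X i),
      ?_, ?_, ?_, ?_⟩
    · refine (MvPolynomial.totalDegree_mul _ _).trans ?_
      rw [MvPolynomial.totalDegree_C, zero_add]
      refine (MvPolynomial.totalDegree_sub _ _).trans (max_le (by simp) ?_)
      refine MvPolynomial.totalDegree_finsetSum_le fun i _ => ?_
      refine (MvPolynomial.totalDegree_mul _ _).trans ?_
      rw [MvPolynomial.totalDegree_C, zero_add]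
      exact (MvPolynomial.totalDegree_X i).le.trans one_le_two
    · intro x hx
      rw [hS]
      have := abs_le.1 (hin x hx)
      constructor <;> linarith
    · intro x hx R hR
      rw [hS, hS, inner_add_right, inner_smul_right, inner_sub_right, real_inner_self_eq_norm_sq,
        h1]
      refine le_of_eq ?_
      ring
    · intro x hx
      have ht := polyFun_le_taylor f ha hx
      rw [inner_gradient_of_isMinOn f h1 hmin] at ht
      rw [hS]
      have h0 : 0 ≤ 1 - ⟪a, x⟫_ℝ := by linarith [(abs_le.1 (hin x hx)).2]
      -- On the boundary the quadratic Taylor term is thus also controlled by the linear gauge, for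
      -- a total of (|β| + 2|γ|)(1 - ⟪a, x⟫) = (2|β| + 4|γ|) S.
      have h2 : ‖x - a‖ ^ 2 ≤ 2 * (1 - ⟪a, x⟫_ℝ) := by
        rw [norm_sub_sq_real, h1, real_inner_comm]
        have := pow_le_one₀ (norm_nonneg x) (hnorm x hx) (n := 2)
        linarith
      have h3 : γ * ‖x - a‖ ^ 2 ≤ |γ| * (2 * (1 - ⟪a, x⟫_ℝ)) :=
        mul_le_mul (le_abs_self _) h2 (sq_nonneg _) (abs_nonneg _)
      have h4 : ‖gradient (polyFun f) a‖ * (1 - ⟪a, x⟫_ℝ) ≤ |β| * (1 - ⟪a, x⟫_ℝ) := by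
        gcongr
        exact (norm_gradient_le_gradConst f ha).trans (le_abs_self _)
      linarith

theorem exists_ubError_le (n : ℕ) {lam : ℝ} (hlam : 0 ≤ lam) :
    ∃ C : ℝ, 0 < C ∧ ∀ (f : MvPolynomial (Fin n) ℝ), ∀ a ∈ unitBall n,
      IsMinOn (polyFun f) (unitBall n) a → ∀ r : ℕ, 1 ≤ r →
        ubError (unitBall n) (ballMeasure n lam) f r ≤
          C * (2 * |gradConst (unitBall n) f| + 4 * |hessConst (unitBall n) f|) / (r : ℝ) ^ 2 := by
  obtain ⟨C, hC, hneedle⟩ := exists_needle (n + ⌈lam⌉₊)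
  refine ⟨C, hC, fun f a ha hmin r hr => ?_⟩
  obtain ⟨p, hpdeg, hp⟩ := hneedle r hr
  obtain ⟨S, hSdeg, hS01, hSc, hfS⟩ := exists_gauge f ha hmin
  have hSm := continuous_polyFun S
  have hf := continuous_polyFun f
  have hpc := p.continuous
  set A := 2 * |gradConst (unitBall n) f| + 4 * |hessConst (unitBall n) f|
  have hA : 0 ≤ A := by positivity
  have hfin := ballMeasure_finite (n := n) hlam
  obtain ⟨hpos, hle⟩ := hp (ballMeasure n lam) (polyFun S) hSm.measurable
    ((ae_mem_unitBall lam).mono hS01) (ballMeasure_univ_ne_zero lam)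
    (fun M hM R hR => ballMeasure_sublevel_le hlam (Nat.le_ceil lam) ha hSm.measurable hSc hM hR)
  refine ubError_le_of_competitor (h := Polynomial.aeval S p) hlam ha hmin ?_ ?_ ?_
  · have := totalDegree_aeval_le p S hSdeg
    omega
  · simpa only [polyFun_aeval] using hpos
  · simp only [polyFun_aeval]
    calc _ ≤ ∫ x, A * (polyFun S x * p.eval (polyFun S x) ^ 2) ∂(ballMeasure n lam) := by
          refine integral_mono_ae (integrable_ballMeasure hlam (by fun_prop))
            (integrable_ballMeasure hlam (by fun_prop)) ?_
          filter_upwards [ae_mem_unitBall lam] with x hx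
          rw [← mul_assoc]
          exact mul_le_mul_of_nonneg_right (hfS x hx) (sq_nonneg _)
      _ = A * ∫ x, polyFun S x * p.eval (polyFun S x) ^ 2 ∂(ballMeasure n lam) :=
          integral_const_mul _ _
      _ ≤ A * (C / r ^ 2 * ∫ x, p.eval (polyFun S x) ^ 2 ∂(ballMeasure n lam)) := by gcongr
      _ = _ := by ring

end LasserreBall

theorem mainTheorem4 (n : ℕ) (hn : 2 ≤ n) :
    (∃ c : ℝ → ℝ → ℝ, (∀ β γ, 0 < c β γ) ∧
      ∀ f : MvPolynomial (Fin n) ℝ, ∀ r : ℕ, 1 ≤ r →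
        LasserreBall.ubError (LasserreBall.unitBall n) (LasserreBall.ballMeasure n 0) f r ≤
          c (LasserreBall.gradConst (LasserreBall.unitBall n) f)
            (LasserreBall.hessConst (LasserreBall.unitBall n) f) / (r : ℝ) ^ 2) ∧
    (∀ lam : ℝ, 0 < lam →
      ∃ c : EuclideanSpace ℝ (Fin n) → ℝ → ℝ → ℝ, (∀ a β γ, 0 < c a β γ) ∧
        ∀ f : MvPolynomial (Fin n) ℝ, ∀ a ∈ LasserreBall.unitBall n,
          IsMinOn (LasserreBall.polyFun f) (LasserreBall.unitBall n) a →
          ∀ r : ℕ, 1 ≤ r →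
            LasserreBall.ubError (LasserreBall.unitBall n) (LasserreBall.ballMeasure n lam) f r ≤
              c a (LasserreBall.gradConst (LasserreBall.unitBall n) f)
                (LasserreBall.hessConst (LasserreBall.unitBall n) f) / (r : ℝ) ^ 2) := by
  refine ⟨?_, fun lam hlam => ?_⟩
  · obtain ⟨C, hC, h⟩ := LasserreBall.exists_ubError_le n le_rfl
    -- The added 1 keeps the constant positive when β = γ = 0.
    refine ⟨fun β γ => C * (2 * |β| + 4 * |γ| + 1), fun β γ => by positivity, fun f r hr => ?_⟩
    obtain ⟨a, ha, hmin⟩ := (isCompact_closedBall (0 : EuclideanSpace ℝ (Fin n)) 1).exists_isMinOn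
      ⟨0, by simp⟩ (LasserreBall.continuous_polyFun f).continuousOn
    refine (h f a ha hmin r hr).trans ?_
    gcongr
    linarith
  · obtain ⟨C, hC, h⟩ := LasserreBall.exists_ubError_le n hlam.le
    refine ⟨fun _ β γ => C * (2 * |β| + 4 * |γ| + 1), fun _ β γ => by positivity,
      fun f a ha hmin r hr => (h f a ha hmin r hr).trans ?_⟩
    gcongr
    linarith
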